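/- For $n\ge 0$ let $TH_4(n)$ be the 4-dimensional Tower of Hanoi graph at stage $n$. It has $5^{n+1}$ vertices, five of which, labelled $1,\dots,5$, are its outmost vertices, and it is defined recursively: $TH_4(0)$ is the complete graph on five vertices, all of them outmost; $TH_4(n+1)$ consists of five disjoint copies of $TH_4(n)$, numbered $1,\dots,5$, together with, for each pair $i\neq j$, one additional edge joining outmost vertex $j$ of copy $i$ to outmost vertex $i$ of copy $j$; outmost vertex $i$ of $TH_4(n+1)$ is outmost vertex $i$ of copy $i$. Let $M_4(n)$ be the number of dimer-monomers on $TH_4(n)$, that is, the number of matchings of $TH_4(n)$ (sets of edges, no two of which have a common vertex, the empty set included). Proposition. The entropy per site $$z_{TH_4}=\lim_{n\to\infty}\frac{\ln M_4(n)}{5^{n+1}}$$ exists, and its decimal expansion begins $z_{TH_4}=0.72291383087181938879\ldots$, that is, $$0.72291383087181938879\le z_{TH_4}<0.72291383087181938880 .$$ -/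

import Mathlib

open Filter Topology

/-- The `d`-dimensional Tower of Hanoi graph at stage `n`. Its vertices are the words
`x 0, x 1, …, x n` over the alphabet `Fin (d + 1)`: the first letter `x 0` names the copy of the
previous stage that contains the vertex, and the tail of the word is the vertex inside that copy.
Stage `0` is the complete graph on `d + 1` vertices. Stage `n + 1` consists of `d + 1` disjoint
copies of stage `n`; for `i ≠ j`, one further edge joins outmost vertex `j` of copy `i` to outmost
vertex `i` of copy `j`, where outmost vertex `i` is the constant word `i, i, …, i` (so outmost
vertex `i` of copy `i` is left over as the outmost vertex `i` of stage `n + 1`). -/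
def towerOfHanoi (d : ℕ) : (n : ℕ) → SimpleGraph (Fin (n + 1) → Fin (d + 1))
  | 0 => ⊤
  | n + 1 =>
    { Adj := fun x y =>
        (x 0 = y 0 ∧ (towerOfHanoi d n).Adj (Fin.tail x) (Fin.tail y)) ∨
        (x 0 ≠ y 0 ∧ Fin.tail x = (fun _ => y 0) ∧ Fin.tail y = (fun _ => x 0))
      symm := ⟨by
        rintro x y (⟨h, h'⟩ | ⟨h, h₁, h₂⟩)
        · exact Or.inl ⟨h.symm, h'.symm⟩
        · exact Or.inr ⟨h.symm, h₂, h₁⟩⟩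
      loopless := ⟨by
        rintro x (⟨_, h⟩ | ⟨h, _⟩)
        · exact h.ne rfl
        · exact h rfl⟩ }

/-- A set `S` of edges of `G` is a matching if no two distinct members of `S` have a common
vertex. -/
def IsEdgeMatching {V : Type*} (G : SimpleGraph V) (S : Set (Sym2 V)) : Prop :=
  S ⊆ G.edgeSet ∧ ∀ e ∈ S, ∀ e' ∈ S, ∀ v : V, v ∈ e → v ∈ e' → e = e'

/-- The number of dimer-monomers on `G`, that is, the number of its matchings (the empty one
included): the edges of the matching are the dimers, the uncovered vertices the monomers. -/
noncomputable def numDimerMonomers {V : Type*} (G : SimpleGraph V) : ℕ :=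
  {S : Set (Sym2 V) | IsEdgeMatching G S}.ncard

/-!
Let `a_n(k)` be the number of matchings of the stage `n` graph that leave `k` given outmost vertices
uncovered; by symmetry it does not depend on which ones. A matching of stage `n + 1` consists of the
set of glueing edges it uses, which is a graph `H` on the `d + 1` copies, and of a matching of each
copy that avoids the ends of these edges. Hence (`cornerCount_succ`, `cornerCount_eq_cornerNumber`)
`a_{n+1}(k) = ∑_H ∏_i a_n(deg_H i + [i < k])`.

This recursion maps a geometric sequence `A * x ^ k` to `A ^ (d + 1) * S * x ^ k`, where
`S = ∑_H ∏_i x ^ deg_H i`: the ratio `x` is preserved. The recursion is monotone and homogeneous of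
degree `d + 1`, so if `A * x ^ k ≤ a_n(k) ≤ ρ * A * x ^ k` at one stage, the same holds at the next
one with `ρ ^ (d + 1)` in place of `ρ` (`NearGeometric.succ`). Dividing logarithms by the number of
vertices, the entropy lies between `(log A + log S / d) / (d + 1) ^ (n + 1)` and the same quantity
with `log ρ` added to the numerator (`exists_tendsto_log_cornerNumber`). The limit exists because
`a_{n+1}(0) ≥ a_n(0) ^ (d + 1)` makes the quotients monotone.

For `d = 4` one has `S = (1 + x ^ 2) ^ 10`. At stage `4` the exact values, integers of about a
thousand digits that the kernel computes from the recursion, are geometric up to a factor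
`1 + 10 ^ (-28)`, because correlations between outmost vertices decay doubly exponentially. What
remains is one logarithm, `4 * log A + 10 * log (1 + x ^ 2)`, which is written as
`13036 * log 2 + log m` with `1 < m < 2` and estimated by the series of
`log ((1 + y) / (1 - y))`.
-/

variable {V : Type*} {R : Type*} [CommSemiring R] {d n m : ℕ}

/-! ### Matchings of the Tower of Hanoi graph -/

/-- The matchings of `G` that leave every vertex of `A` uncovered. A matching is encoded as the
subgraph `M ≤ G` formed by its edges: every vertex has at most one neighbour in `M`. -/
def matchingsAvoiding (G : SimpleGraph V) (A : Set V) : Set (SimpleGraph V) :=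
  {M | M ≤ G ∧ (∀ u v w, M.Adj u v → M.Adj u w → v = w) ∧ ∀ u ∈ A, ∀ v, ¬ M.Adj u v}

theorem numDimerMonomers_eq_ncard (G : SimpleGraph V) :
    numDimerMonomers G = (matchingsAvoiding G ∅).ncard := by
  rw [numDimerMonomers, ← Set.ncard_image_of_injective _ SimpleGraph.edgeSet_injective]
  congr 1
  ext S
  simp only [Set.mem_ofPred_eq, Set.mem_image, matchingsAvoiding, Set.mem_empty_iff_false,
    IsEmpty.forall_iff, implies_true, and_true]
  constructor
  · rintro ⟨hS, h⟩
    have hS' : (SimpleGraph.fromEdgeSet S).edgeSet = S := by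
      rw [SimpleGraph.edgeSet_fromEdgeSet, sdiff_eq_left, Set.disjoint_left]
      exact fun e he hd => G.not_isDiag_of_mem_edgeSet (hS he) hd
    refine ⟨SimpleGraph.fromEdgeSet S, ⟨?_, ?_⟩, hS'⟩
    · rwa [← SimpleGraph.edgeSet_subset_edgeSet, hS']
    · intro u v w hv hw
      rw [SimpleGraph.fromEdgeSet_adj] at hv hw
      exact Sym2.congr_right.1 (h _ hv.1 _ hw.1 u (Sym2.mem_mk_left _ _) (Sym2.mem_mk_left _ _))
  · rintro ⟨M, ⟨hM, h⟩, rfl⟩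
    refine ⟨SimpleGraph.edgeSet_mono hM, fun e he e' he' v hv hv' => ?_⟩
    obtain ⟨a, rfl⟩ := hv
    obtain ⟨b, rfl⟩ := hv'
    rw [h v a b he he']

/-- The graph on the words of length `n + 2` that carries the graph `N i` on copy `i` (the words
with first letter `i`) and, for each edge `ij` of `H`, the edge joining outmost vertex `j` of copy
`i` to outmost vertex `i` of copy `j`. Taking `H = ⊤` and every `N i` the stage `n` graph gives
stage `n + 1`; taking matchings for the `N i` assembles a matching of stage `n + 1`. -/
def glue {d n : ℕ} (H : SimpleGraph (Fin (d + 1)))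
    (N : Fin (d + 1) → SimpleGraph (Fin (n + 1) → Fin (d + 1))) :
    SimpleGraph (Fin (n + 2) → Fin (d + 1)) where
  Adj x y :=
    (x 0 = y 0 ∧ (N (x 0)).Adj (Fin.tail x) (Fin.tail y)) ∨
    (H.Adj (x 0) (y 0) ∧ Fin.tail x = (fun _ => y 0) ∧ Fin.tail y = (fun _ => x 0))
  symm := ⟨by
    rintro x y (⟨h, h'⟩ | ⟨h, h₁, h₂⟩)
    · exact Or.inl ⟨h.symm, h ▸ h'.symm⟩
    · exact Or.inr ⟨h.symm, h₂, h₁⟩⟩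
  loopless := ⟨by
    rintro x (⟨_, h⟩ | ⟨h, _⟩)
    · exact h.ne rfl
    · exact h.ne rfl⟩

/-- The number of matchings of the stage `n` graph that leave the outmost vertices labelled by `K`
uncovered. -/
noncomputable def cornerCount (d n : ℕ) (K : Set (Fin (d + 1))) : ℕ :=
  (matchingsAvoiding (towerOfHanoi d n) ((fun i _ => i) '' K)).ncard

theorem towerOfHanoi_succ (d n : ℕ) :
    towerOfHanoi d (n + 1) = glue ⊤ fun _ => towerOfHanoi d n := rfl

@[simp]
theorem glue_adj_cons (H : SimpleGraph (Fin (d + 1)))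
    (N : Fin (d + 1) → SimpleGraph (Fin (n + 1) → Fin (d + 1))) (i j : Fin (d + 1))
    (u v : Fin (n + 1) → Fin (d + 1)) :
    (glue H N).Adj (Fin.cons i u : Fin (n + 2) → Fin (d + 1)) (Fin.cons j v) ↔
      (i = j ∧ (N i).Adj u v) ∨ (H.Adj i j ∧ u = (fun _ => j) ∧ v = fun _ => i) := by
  simp [glue]

theorem const_word_eq_cons (i : Fin (d + 1)) :
    (fun _ => i : Fin (n + 2) → Fin (d + 1)) = Fin.cons i fun _ => i := by
  ext k
  refine Fin.cases ?_ (fun _ => ?_) k <;> simp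

theorem const_word_inj {i j : Fin (d + 1)} :
    ((fun _ => i : Fin (n + 1) → Fin (d + 1)) = fun _ => j) ↔ i = j :=
  ⟨fun h => congrFun h 0, fun h => h ▸ rfl⟩

/-- A vertex of copy `i` may meet a glueing edge only if the matching inside copy `i` leaves it
uncovered; hence the set of outmost vertices of copy `i` to be avoided. -/
theorem glue_mem_matchingsAvoiding (K : Set (Fin (d + 1))) (H : SimpleGraph (Fin (d + 1)))
    (N : Fin (d + 1) → SimpleGraph (Fin (n + 1) → Fin (d + 1)))
    (hN : ∀ i, N i ∈ matchingsAvoiding (towerOfHanoi d n)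
      ((fun j _ => j) '' {j | H.Adj i j ∨ (j = i ∧ i ∈ K)})) :
    glue H N ∈ matchingsAvoiding (towerOfHanoi d (n + 1)) ((fun i _ => i) '' K) := by
  have hav : ∀ i j v, (H.Adj i j ∨ (j = i ∧ i ∈ K)) → ¬ (N i).Adj (fun _ => j) v :=
    fun i j v hj => (hN i).2.2 _ ⟨j, hj, rfl⟩ v
  refine ⟨?_, ?_, ?_⟩
  · rintro x y (⟨h, h'⟩ | ⟨h, h'⟩)
    · exact Or.inl ⟨h, (hN _).1 h'⟩
    · exact Or.inr ⟨h.ne, h'⟩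
  · intro x y z
    induction x using Fin.consCases with | _ i u
    induction y using Fin.consCases with | _ j v
    induction z using Fin.consCases with | _ k w
    simp only [glue_adj_cons]
    rintro (⟨rfl, h⟩ | ⟨h, rfl, rfl⟩) (⟨rfl, h'⟩ | ⟨h', h₁, rfl⟩)
    · rw [(hN _).2.1 _ _ _ h h']
    · subst h₁
      exact (hav _ _ _ (Or.inl h') h).elim
    · exact (hav _ _ _ (Or.inl h) h').elim
    · rw [const_word_inj.1 h₁]
  · rintro _ ⟨k, hk, rfl⟩ y
    induction y using Fin.consCases with | _ j v
    dsimp only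
    rw [const_word_eq_cons, glue_adj_cons]
    rintro (⟨rfl, h⟩ | ⟨h, h₁, rfl⟩)
    · exact hav _ _ _ (Or.inr ⟨rfl, hk⟩) h
    · exact h.ne (const_word_inj.1 h₁)

/-- A matching of stage `n + 1` is determined by the pattern `H` of glueing edges it uses together
with its restrictions to the copies. -/
theorem cornerCount_succ (K : Set (Fin (d + 1))) :
    cornerCount d (n + 1) K = ∑ H : SimpleGraph (Fin (d + 1)),
      ∏ i, cornerCount d n {j | H.Adj i j ∨ (j = i ∧ i ∈ K)} := by
  simp only [cornerCount, ← Nat.card_coe_set_eq]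
  simp only [← Nat.card_pi]
  rw [← Nat.card_sigma]
  symm
  refine Nat.card_congr (Equiv.ofBijective (fun p => ⟨glue p.1 fun i => (p.2 i).1,
    glue_mem_matchingsAvoiding K p.1 _ fun i => (p.2 i).2⟩) ⟨?_, ?_⟩)
  · rintro ⟨H, N⟩ ⟨H', N'⟩ h
    have h : glue H (fun i => (N i).1) = glue H' (fun i => (N' i).1) := congrArg Subtype.val h
    have hadj : ∀ i j u v, _ ↔ _ := fun i j u v => by
      have := congrArg (fun G => G.Adj (Fin.cons i u : Fin (n + 2) → Fin (d + 1)) (Fin.cons j v)) h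
      simp only [glue_adj_cons] at this
      exact Iff.of_eq this
    obtain rfl : H = H' := by
      ext i j
      have := hadj i j (fun _ => j) (fun _ => i)
      by_cases hij : i = j
      · subst hij
        simp
      · simpa [hij] using this
    congr 1
    funext i
    ext u v
    simpa using hadj i i u v
  -- The pattern and the restrictions of a given matching `M` are a preimage of `M`.
  · rintro ⟨M, hM, hM₁, hM₂⟩
    have hle : ∀ i j u v, M.Adj (Fin.cons i u : Fin (n + 2) → Fin (d + 1)) (Fin.cons j v) →
        (i = j ∧ (towerOfHanoi d n).Adj u v) ∨ (i ≠ j ∧ u = (fun _ => j) ∧ v = fun _ => i) := by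
      intro i j u v h
      have := hM h
      rw [towerOfHanoi_succ, glue_adj_cons] at this
      simpa using this
    let H : SimpleGraph (Fin (d + 1)) :=
      { Adj := fun i j => i ≠ j ∧
          M.Adj (Fin.cons i fun _ => j : Fin (n + 2) → Fin (d + 1)) (Fin.cons j fun _ => i)
        symm := ⟨fun i j h => ⟨h.1.symm, h.2.symm⟩⟩
        loopless := ⟨fun i h => h.1 rfl⟩ }
    refine ⟨⟨H, fun i => ⟨M.comap fun u => (Fin.cons i u : Fin (n + 2) → Fin (d + 1)), ?_, ?_, ?_⟩⟩,
      Subtype.ext ?_⟩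
    · intro u v h
      simpa using hle _ _ _ _ h
    · intro u v w h h'
      exact (Fin.cons_inj.1 (hM₁ _ _ _ h h')).2
    · rintro _ ⟨j, hj | ⟨rfl, hi⟩, rfl⟩ v h
      · exact hj.1 (Fin.cons_inj.1 (hM₁ _ _ _ h hj.2)).1
      · refine hM₂ _ ⟨j, hi, rfl⟩ (Fin.cons j v) ?_
        dsimp only
        rw [const_word_eq_cons]
        exact h
    · ext x y
      induction x using Fin.consCases with | _ i u
      induction y using Fin.consCases with | _ j v
      rw [glue_adj_cons]
      constructor
      · rintro (⟨rfl, h⟩ | ⟨h, rfl, rfl⟩)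
        · exact h
        · exact h.2
      · intro h
        obtain ⟨rfl, _⟩ | ⟨hij, rfl, rfl⟩ := hle _ _ _ _ h
        · exact Or.inl ⟨rfl, h⟩
        · exact Or.inr ⟨⟨hij, h⟩, rfl, rfl⟩

/-! ### Dependence on the number of outmost vertices only -/

open Classical in
/-- The sum over all graphs `H` on `Fin m` of the product of `f (o i + deg_H i)` over the vertices
`i`. Here `H` is a pattern of glueing edges and the offset `o i` counts further constraints on
copy `i`. -/
noncomputable def patternSum (f : ℕ → R) (o : Fin m → ℕ) : R :=
  ∑ H : SimpleGraph (Fin m), ∏ i, f (o i + ∑ j, if H.Adj i j then 1 else 0)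

open Classical in
theorem patternSum_comp_perm (f : ℕ → R) (o : Fin m → ℕ) (σ : Equiv.Perm (Fin m)) :
    patternSum f (fun i => o (σ i)) = patternSum f o := by
  unfold patternSum
  refine Fintype.sum_equiv σ.simpleGraph _ _ fun H => ?_
  rw [← Equiv.prod_comp σ fun i => f (o i + _)]
  refine Finset.prod_congr rfl fun i _ => ?_
  rw [← Equiv.sum_comp σ fun j => if (σ.simpleGraph H).Adj (σ i) j then 1 else 0]
  simp

open Classical in
theorem Set.ncard_eq_sum_ite (A : Set (Fin m)) : A.ncard = ∑ j, if j ∈ A then 1 else 0 := by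
  rw [Set.ncard_eq_toFinset_card', Finset.sum_boole]
  simp only [Nat.cast_id]
  congr 1
  ext; simp

open Classical in
/-- A permutation of the vertices carrying `K` to an initial segment shows that only the size of `K`
matters. -/
theorem patternSum_indicator (f : ℕ → R) (K : Set (Fin m)) :
    patternSum f (fun i => if i ∈ K then 1 else 0) =
      patternSum f fun i : Fin m => if i.val < K.ncard then 1 else 0 := by
  have hc : Fintype.card {i // i ∈ K} = Fintype.card {i : Fin m // i.val < K.ncard} := by
    rw [Fintype.card_subtype, Fintype.card_subtype, Fin.card_filter_val_lt,
      Set.ncard_eq_sum_ite, Finset.sum_boole]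
    have := Finset.card_le_univ (Finset.univ.filter fun i => i ∈ K)
    simp at this ⊢
    omega
  let e := Fintype.equivOfCardEq hc
  rw [← patternSum_comp_perm f (fun i : Fin m => if i.val < K.ncard then 1 else 0) e.extendSubtype]
  congr 1
  funext i
  by_cases hi : i ∈ K
  · rw [if_pos hi, if_pos (e.extendSubtype_mem i hi)]
  · rw [if_neg hi, if_neg (e.extendSubtype_not_mem i hi)]

/-- `cornerNumber d (n + 1) k` is the number of matchings of the stage `n` graph that leave `k`
given outmost vertices uncovered. The index is shifted by one so that the recursion also produces
stage `0`, whose copies are single vertices: `cornerNumber d 0 k` is `1` or `0` according as at most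
one glueing edge or exclusion falls on such a vertex, or more than one. -/
noncomputable def cornerNumber (d : ℕ) : ℕ → ℕ → ℕ
  | 0, k => if k ≤ 1 then 1 else 0
  | n + 1, k => patternSum (cornerNumber d n) fun i : Fin (d + 1) => if i.val < k then 1 else 0

open Classical in
theorem sum_adj_add_ite_le_one {H : SimpleGraph (Fin m)} {K : Set (Fin m)} {i : Fin m} :
    ((if i ∈ K then 1 else 0) + ∑ j, if H.Adj i j then 1 else 0) ≤ 1 ↔
      (∀ v w, H.Adj i v → H.Adj i w → v = w) ∧ (i ∈ K → ∀ v, ¬ H.Adj i v) := by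
  rw [Finset.sum_boole, Nat.cast_id]
  by_cases hi : i ∈ K
  · rw [if_pos hi]
    simp only [hi, forall_true_left]
    have : 1 + (Finset.univ.filter fun j => H.Adj i j).card ≤ 1 ↔
      (Finset.univ.filter fun j => H.Adj i j).card = 0 := by omega
    rw [this, Finset.card_eq_zero, Finset.filter_eq_empty_iff]
    simp only [Finset.mem_univ, forall_true_left]
    exact ⟨fun h => ⟨fun v w hv => (h hv).elim, fun _ => @h _⟩, fun h => @h.2⟩
  · rw [if_neg hi, zero_add]
    simp only [hi, IsEmpty.forall_iff, and_true]
    rw [Finset.card_le_one]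
    simp only [Finset.mem_filter, Finset.mem_univ, true_and]
    exact ⟨fun h v w hv hw => h v hv w hw, fun h v hv w hw => h v w hv hw⟩

open Classical in
theorem cornerCount_zero (d : ℕ) (K : Set (Fin (d + 1))) :
    cornerCount d 0 K = patternSum (fun k => if k ≤ 1 then 1 else 0)
      fun i => if i ∈ K then 1 else 0 := by
  unfold patternSum cornerCount
  simp only [Finset.prod_ite_zero, Finset.prod_const_one, Finset.mem_univ, forall_true_left]
  rw [Finset.sum_boole, Nat.cast_id, ← Set.ncard_coe_finset]
  let e : (Fin 1 → Fin (d + 1)) ≃ Fin (d + 1) := Equiv.funUnique _ _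
  rw [← Set.ncard_image_of_injective _ e.simpleGraph.injective]
  congr 1
  rw [Equiv.image_eq_preimage_symm]
  ext H
  simp only [matchingsAvoiding, Set.mem_preimage, Set.mem_ofPred_eq, Finset.coe_filter,
    Finset.mem_univ, true_and, sum_adj_add_ite_le_one, towerOfHanoi, le_top,
    Set.forall_mem_image]
  rw [forall_and]
  refine and_congr ⟨fun h i v w hv hw => ?_, fun h u v w hv hw => ?_⟩
    ⟨fun h i hi v hv => ?_, fun h i hi v hv => ?_⟩
  · exact e.symm.injective (h (e.symm i) (e.symm v) (e.symm w) (by simpa using hv)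
      (by simpa using hw))
  · exact e.injective (h (e u) (e v) (e w) (by simpa using hv) (by simpa using hw))
  · refine h hi (e.symm v) ?_
    simpa [e] using hv
  · refine h i hi (e v) ?_
    simpa [e] using hv

theorem cornerCount_eq_cornerNumber (d n : ℕ) (K : Set (Fin (d + 1))) :
    cornerCount d n K = cornerNumber d (n + 1) K.ncard := by
  classical
  induction n generalizing K with
  | zero =>
    rw [cornerCount_zero, patternSum_indicator]
    rfl
  | succ n ih =>
    rw [cornerCount_succ, cornerNumber, ← patternSum_indicator, patternSum]
    refine Finset.sum_congr rfl fun H _ => Finset.prod_congr rfl fun i _ => ?_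
    rw [ih]
    congr 1
    rw [Set.ncard_eq_sum_ite]
    trans ∑ j, ((if j = i then if i ∈ K then 1 else 0 else 0) + if H.Adj i j then 1 else 0)
    · refine Finset.sum_congr rfl fun j _ => ?_
      by_cases hj : j = i
      · subst hj; simp
      · simp [hj]
    · rw [Finset.sum_add_distrib, Finset.sum_ite_eq' Finset.univ i]
      simp

theorem numDimerMonomers_towerOfHanoi (d n : ℕ) :
    numDimerMonomers (towerOfHanoi d n) = cornerNumber d (n + 1) 0 := by
  have := cornerCount_eq_cornerNumber d n ∅
  rw [Set.ncard_empty] at this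
  rw [← this, cornerCount, Set.image_empty, numDimerMonomers_eq_ncard]

/-! ### Evaluation of pattern sums -/

/-- The graph obtained from `H` by adding the vertex `0`, adjacent to the vertices selected by
`b`. -/
def addVertex (b : Fin m → Bool) (H : SimpleGraph (Fin m)) : SimpleGraph (Fin (m + 1)) where
  Adj x y := Fin.cases (Fin.cases False (fun j => b j = true) y)
    (fun i => Fin.cases (b i = true) (fun j => H.Adj i j) y) x
  symm := ⟨fun x y => by
    refine Fin.cases ?_ (fun i => ?_) x <;> refine Fin.cases ?_ (fun j => ?_) y
    · exact id
    · exact id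
    · exact id
    · exact fun h => SimpleGraph.Adj.symm h⟩
  loopless := ⟨fun x => by
    refine Fin.cases ?_ (fun i => ?_) x
    · exact id
    · exact H.loopless.irrefl i⟩

@[simp] theorem addVertex_adj_zero_zero (b : Fin m → Bool) (H : SimpleGraph (Fin m)) :
    (addVertex b H).Adj 0 0 ↔ False := Iff.rfl

@[simp] theorem addVertex_adj_zero_succ (b : Fin m → Bool) (H : SimpleGraph (Fin m)) (j : Fin m) :
    (addVertex b H).Adj 0 j.succ ↔ b j = true := Iff.rfl

@[simp] theorem addVertex_adj_succ_zero (b : Fin m → Bool) (H : SimpleGraph (Fin m)) (i : Fin m) :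
    (addVertex b H).Adj i.succ 0 ↔ b i = true := Iff.rfl

@[simp] theorem addVertex_adj_succ_succ (b : Fin m → Bool) (H : SimpleGraph (Fin m))
    (i j : Fin m) : (addVertex b H).Adj i.succ j.succ ↔ H.Adj i j := Iff.rfl

theorem addVertex_bijective :
    Function.Bijective fun p : (Fin m → Bool) × SimpleGraph (Fin m) => addVertex p.1 p.2 := by
  classical
  constructor
  · rintro ⟨b, H⟩ ⟨b', H'⟩ h
    have h : addVertex b H = addVertex b' H' := h
    refine Prod.ext (funext fun j => ?_) (SimpleGraph.ext (funext₂ fun i j => ?_))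
    · rw [Bool.eq_iff_iff, ← addVertex_adj_zero_succ b H, h, addVertex_adj_zero_succ]
    · dsimp only
      rw [← addVertex_adj_succ_succ b H, h, addVertex_adj_succ_succ]
  · intro G
    refine ⟨⟨fun j => decide (G.Adj 0 j.succ), G.comap Fin.succ⟩, ?_⟩
    ext x y
    refine Fin.cases ?_ (fun i => ?_) x <;> refine Fin.cases ?_ (fun j => ?_) y
    · simp
    · simp
    · simp [G.adj_comm]
    · simp

/-- The sum over graphs on `m + 1` vertices, split according to the neighbours `b` of vertex `0`. -/
theorem patternSum_succ (f : ℕ → R) (o : Fin (m + 1) → ℕ) :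
    patternSum f o = ∑ b : Fin m → Bool, f (o 0 + ∑ i, (b i).toNat) *
      patternSum f fun i => o i.succ + (b i).toNat := by
  classical
  unfold patternSum
  rw [← addVertex_bijective.sum_comp, Fintype.sum_prod_type]
  refine Finset.sum_congr rfl fun b _ => ?_
  rw [Finset.mul_sum]
  refine Finset.sum_congr rfl fun H _ => ?_
  rw [Fin.prod_univ_succ]
  have hb : ∀ i, (if b i = true then 1 else 0) = (b i).toNat := fun i => by cases b i <;> rfl
  simp only [Fin.sum_univ_succ, addVertex_adj_zero_zero, addVertex_adj_zero_succ,
    addVertex_adj_succ_zero, addVertex_adj_succ_succ, hb, if_false, zero_add, add_assoc]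

/-- The sum of `k c l'` over all ways of selecting entries of a list, where `c` is the number of
selected entries and `l'` the list with the selected entries increased by one. -/
def sumNeighbors : List ℕ → (ℕ → List ℕ → R) → R
  | [], k => k 0 []
  | o :: l, k => sumNeighbors l (fun c l' => k c (o :: l')) +
      sumNeighbors l fun c l' => k (c + 1) ((o + 1) :: l')

theorem sumNeighbors_ofFn (o : Fin m → ℕ) (k : ℕ → List ℕ → R) :
    sumNeighbors (List.ofFn o) k =
      ∑ b : Fin m → Bool, k (∑ i, (b i).toNat) (List.ofFn fun i => o i + (b i).toNat) := by
  induction m generalizing k with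
  | zero => simp [sumNeighbors]
  | succ m ih =>
    rw [List.ofFn_succ, sumNeighbors, ih, ih, ← (Fin.consEquiv fun _ => Bool).sum_comp,
      Fintype.sum_prod_type, Fintype.sum_bool, add_comm]
    simp [Fin.consEquiv, Fin.sum_univ_succ, List.ofFn_succ, add_comm]

/-- `patternSum` on lists of offsets, computed by removing the vertices one at a time: the first one
contributes `f` of its offset plus its number of neighbours, and each neighbour's offset grows by
one. This form can be evaluated by the kernel. -/
def listPatternSum (f : ℕ → R) : ℕ → List ℕ → R
  | 0, _ => 1
  | m + 1, l => sumNeighbors l.tail fun c l' => f (l.headD 0 + c) * listPatternSum f m l'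

theorem patternSum_eq_listPatternSum (f : ℕ → R) (o : Fin m → ℕ) :
    patternSum f o = listPatternSum f m (List.ofFn o) := by
  induction m with
  | zero => simp [patternSum, listPatternSum]
  | succ m ih =>
    rw [patternSum_succ, listPatternSum, List.ofFn_succ, List.tail_cons, sumNeighbors_ofFn]
    simp only [ih, List.headD_cons]

theorem patternSum_pow_five (x : R) :
    patternSum (fun k => x ^ k) (fun _ : Fin 5 => 0) = (1 + x ^ 2) ^ 10 := by
  rw [patternSum_eq_listPatternSum]
  simp only [listPatternSum, sumNeighbors, List.ofFn_succ, List.ofFn_zero, List.tail_cons,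
    List.headD_cons]
  ring

/-! ### Kernel evaluation in dimension four -/

/-- Application of `k` to `n` through the recursor, which makes the kernel reduce `n` to a numeral
before it unfolds `k`. -/
def Nat.force {α : Type*} (n : ℕ) (k : ℕ → α) : α :=
  Nat.rec (k 0) (fun m _ => k m.succ) n

theorem Nat.force_eq {α : Type*} (n : ℕ) (k : ℕ → α) : n.force k = k n := by
  cases n <;> rfl

/-- Application of `k` to `l`, after the kernel has reduced all entries of `l` to numerals. -/
def List.force {α : Type*} : List ℕ → (List ℕ → α) → α
  | [], k => k []
  | a :: l, k => a.force fun a' => l.force fun l' => k (a' :: l')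

theorem List.force_eq {α : Type*} (l : List ℕ) (k : List ℕ → α) : l.force k = k l := by
  induction l generalizing k with
  | nil => rfl
  | cons a l ih => rw [List.force, Nat.force_eq, ih]

/-- The list of `cornerNumber 4 n k` for `k = 0, …, 5`, in a form the kernel can evaluate. -/
def cornerNumberList : ℕ → List ℕ
  | 0 => [1, 1, 0, 0, 0, 0]
  | n + 1 => (cornerNumberList n).force fun l =>
      [listPatternSum (fun k => l.getD k 0) 5 [0, 0, 0, 0, 0],
       listPatternSum (fun k => l.getD k 0) 5 [1, 0, 0, 0, 0],
       listPatternSum (fun k => l.getD k 0) 5 [1, 1, 0, 0, 0],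
       listPatternSum (fun k => l.getD k 0) 5 [1, 1, 1, 0, 0],
       listPatternSum (fun k => l.getD k 0) 5 [1, 1, 1, 1, 0],
       listPatternSum (fun k => l.getD k 0) 5 [1, 1, 1, 1, 1]]

open Classical in
theorem sum_adj_le (H : SimpleGraph (Fin (m + 1))) (i : Fin (m + 1)) :
    ∑ j, (if H.Adj i j then 1 else 0) ≤ m := by
  rw [Finset.sum_boole, Nat.cast_id, ← Nat.lt_succ_iff]
  refine (Finset.card_lt_univ_of_notMem (x := i) (by simp)).trans_eq (Fintype.card_fin _)

/-- Only the values `f k` with `k ≤ d + 1` occur, since degrees in `H` are at most `d`. -/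
theorem patternSum_congr {f g : ℕ → R} {o : Fin (d + 1) → ℕ} (ho : ∀ i, o i ≤ 1)
    (h : ∀ k ≤ d + 1, f k = g k) :
    patternSum f o = patternSum g o := by
  classical
  refine Finset.sum_congr rfl fun H _ => Finset.prod_congr rfl fun i _ => h _ ?_
  have := sum_adj_le H i
  have := ho i
  omega

theorem cornerNumber_four (n k : ℕ) (hk : k ≤ 5) :
    cornerNumber 4 n k = (cornerNumberList n).getD k 0 := by
  induction n generalizing k with
  | zero => interval_cases k <;> rfl
  | succ n ih =>
    rw [cornerNumber, patternSum_congr (fun i => by split_ifs <;> simp) ih,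
      patternSum_eq_listPatternSum, cornerNumberList, List.force_eq]
    interval_cases k <;> rfl

/-! ### Near-geometric sequences and the entropy -/

/-- On a geometric sequence an offset `o i` only contributes the factor `x ^ o i`. -/
theorem patternSum_geometric (A x : R) (o : Fin m → ℕ) :
    patternSum (fun k => A * x ^ k) o =
      A ^ m * patternSum (fun k => x ^ k) (fun _ : Fin m => 0) * x ^ ∑ i, o i := by
  classical
  unfold patternSum
  rw [Finset.mul_sum, Finset.sum_mul]
  refine Finset.sum_congr rfl fun H _ => ?_
  simp only [pow_add, Finset.prod_mul_distrib, Finset.prod_const, Finset.card_univ,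
    Fintype.card_fin, Finset.prod_pow_eq_pow_sum, pow_zero, one_mul]
  ring

theorem patternSum_mono {f g : ℕ → ℝ} {o : Fin (d + 1) → ℕ} (ho : ∀ i, o i ≤ 1)
    (hf : ∀ k ≤ d + 1, 0 ≤ f k) (h : ∀ k ≤ d + 1, f k ≤ g k) :
    patternSum f o ≤ patternSum g o := by
  classical
  have hk (H : SimpleGraph (Fin (d + 1))) (i : Fin (d + 1)) :
      o i + ∑ j, (if H.Adj i j then 1 else 0) ≤ d + 1 := by
    have := sum_adj_le H i
    have := ho i
    omega
  exact Finset.sum_le_sum fun H _ => Finset.prod_le_prod (fun i _ => hf _ (hk H i))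
    fun i _ => h _ (hk H i)

/-- The empty pattern alone contributes `f 0 ^ m`. -/
theorem pow_le_patternSum_zero {f : ℕ → ℝ} (hf : ∀ k, 0 ≤ f k) :
    f 0 ^ m ≤ patternSum f fun _ : Fin m => 0 := by
  classical
  have := Finset.single_le_sum (f := fun H : SimpleGraph (Fin m) =>
      ∏ i, f (0 + ∑ j, if H.Adj i j then 1 else 0))
    (fun H _ => Finset.prod_nonneg fun i _ => hf _) (Finset.mem_univ ⊥)
  simpa [patternSum] using this

theorem cast_cornerNumber_succ (d n k : ℕ) :
    (cornerNumber d (n + 1) k : ℝ) = patternSum (fun j => (cornerNumber d n j : ℝ))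
      fun i : Fin (d + 1) => if i.val < k then 1 else 0 := by
  simp [cornerNumber, patternSum]

theorem cornerNumber_zero_pow_le (d n : ℕ) :
    (cornerNumber d n 0 : ℝ) ^ (d + 1) ≤ cornerNumber d (n + 1) 0 := by
  rw [cast_cornerNumber_succ]
  simpa using pow_le_patternSum_zero (m := d + 1) fun k => Nat.cast_nonneg (cornerNumber d n k)

theorem one_le_cornerNumber_zero (d n : ℕ) : (1 : ℝ) ≤ cornerNumber d n 0 := by
  induction n with
  | zero => simp [cornerNumber]
  | succ n ih => exact (one_le_pow₀ ih).trans (cornerNumber_zero_pow_le d n)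

/-- The numbers `c 0, …, c (d + 1)` agree with the geometric sequence `A * x ^ k` up to a factor
between `1` and `ρ`. -/
def NearGeometric (d : ℕ) (c : ℕ → ℕ) (A x ρ : ℝ) : Prop :=
  ∀ k ≤ d + 1, A * x ^ k ≤ c k ∧ (c k : ℝ) ≤ ρ * (A * x ^ k)

/-- The recursion maps geometric sequences to geometric sequences with the same ratio `x`, and being
homogeneous of degree `d + 1` it raises the error factor to that power. The error therefore stays of
the same size relative to the number of vertices. -/
theorem NearGeometric.succ {d n : ℕ} {A x ρ : ℝ} (hA : 0 < A) (hx : 0 < x)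
    (h : NearGeometric d (cornerNumber d n) A x ρ) :
    NearGeometric d (cornerNumber d (n + 1))
      (A ^ (d + 1) * patternSum (fun k => x ^ k) fun _ : Fin (d + 1) => 0) x (ρ ^ (d + 1)) := by
  intro k hk
  have ho : ∀ i : Fin (d + 1), (if i.val < k then 1 else 0) ≤ 1 := fun i => by
    split_ifs <;> simp
  have hsum : ∑ i : Fin (d + 1), (if i.val < k then 1 else 0) = k := by
    rw [Finset.sum_boole, Fin.card_filter_val_lt, Nat.cast_id, min_eq_right hk]
  rw [cast_cornerNumber_succ]
  constructor
  · refine le_trans (le_of_eq ?_) (patternSum_mono ho (fun k _ => by positivity)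
      fun k hk => (h k hk).1)
    rw [patternSum_geometric, hsum]
  · refine (patternSum_mono ho (fun k _ => by positivity) fun k hk => (h k hk).2).trans
      (le_of_eq ?_)
    simp_rw [← mul_assoc]
    rw [patternSum_geometric, hsum]
    ring

/-- The recursion `A ↦ A ^ (d + 1) * exp w` multiplies `log A + w / d` by `d + 1`. -/
theorem NearGeometric.log_bounds {d n : ℕ} (hd : d ≠ 0) {A x ρ : ℝ} (hA : 0 < A) (hx : 0 < x)
    (hρ : 1 ≤ ρ) (h : NearGeometric d (cornerNumber d n) A x ρ) {w : ℝ}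
    (hw : w = Real.log (patternSum (fun k => x ^ k) fun _ : Fin (d + 1) => 0)) (j : ℕ) :
    (d + 1) ^ j * (Real.log A + w / d) - w / d ≤ Real.log (cornerNumber d (n + j) 0) ∧
      Real.log (cornerNumber d (n + j) 0) ≤
        (d + 1) ^ j * (Real.log A + w / d + Real.log ρ) - w / d := by
  induction j generalizing n A ρ with
  | zero =>
    obtain ⟨h₁, h₂⟩ := h 0 (Nat.zero_le _)
    rw [pow_zero, mul_one] at h₁ h₂
    have h₃ := Real.log_le_log hA h₁
    have h₄ := Real.log_le_log (hA.trans_le h₁) h₂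
    rw [Real.log_mul (by positivity) hA.ne'] at h₄
    constructor <;> simp only [pow_zero, add_zero] <;> linarith
  | succ j ih =>
    have hS : (0 : ℝ) < patternSum (fun k => x ^ k) fun _ : Fin (d + 1) => 0 :=
      lt_of_lt_of_le (by simp) (pow_le_patternSum_zero (fun k => by positivity))
    have := ih (by positivity) (one_le_pow₀ hρ) (h.succ hA hx)
    rw [Real.log_mul (by positivity) hS.ne', Real.log_pow, Real.log_pow, ← hw] at this
    rw [← add_assoc, add_right_comm]
    have hd' : (d : ℝ) ≠ 0 := Nat.cast_ne_zero.2 hd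
    have h₁ : ((d + 1 : ℕ) : ℝ) * Real.log A + w + w / d = (d + 1) * (Real.log A + w / d) := by
      push_cast
      field_simp
      ring
    rw [h₁] at this
    push_cast at this
    rw [pow_succ]
    constructor
    · refine le_trans (le_of_eq ?_) this.1
      ring
    · refine this.2.trans (le_of_eq ?_)
      ring

/-- The entropy per site exists, and near-geometric numbers at a single stage enclose it. -/
theorem exists_tendsto_log_cornerNumber {d n : ℕ} (hd : d ≠ 0) {A x ρ : ℝ} (hA : 0 < A)
    (hx : 0 < x) (hρ : 1 ≤ ρ) (h : NearGeometric d (cornerNumber d n) A x ρ) {w : ℝ}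
    (hw : w = Real.log (patternSum (fun k => x ^ k) fun _ : Fin (d + 1) => 0)) :
    ∃ z : ℝ, Tendsto (fun k => Real.log (cornerNumber d k 0) / ((d : ℝ) + 1) ^ k) atTop (𝓝 z) ∧
      (Real.log A + w / d) / ((d : ℝ) + 1) ^ n ≤ z ∧
      z ≤ (Real.log A + w / d + Real.log ρ) / ((d : ℝ) + 1) ^ n := by
  have hd0 : (0 : ℝ) < d := by positivity
  have hpos : ∀ k, (0 : ℝ) < ((d : ℝ) + 1) ^ k := fun k => by positivity
  set u : ℕ → ℝ := fun k => Real.log (cornerNumber d k 0) / ((d : ℝ) + 1) ^ k with hu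
  have hmono : Monotone u := monotone_nat_of_le_succ fun k => by
    have h₁ := one_le_cornerNumber_zero d k
    have h₂ := Real.log_le_log (by positivity) (cornerNumber_zero_pow_le d k)
    rw [Real.log_pow] at h₂
    push_cast at h₂
    rw [hu]
    dsimp only
    rw [div_le_div_iff₀ (hpos _) (hpos _), pow_succ]
    nlinarith [hpos k]
  have hw0 : 0 ≤ w / d := by
    have : (1 : ℝ) ≤ patternSum (fun k => x ^ k) fun _ : Fin (d + 1) => 0 := by
      simpa using pow_le_patternSum_zero (m := d + 1) (f := fun k => x ^ k) (fun k => by positivity)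
    rw [hw]
    have := Real.log_nonneg this
    positivity
  have hb := NearGeometric.log_bounds hd hA hx hρ h hw
  have hle : ∀ k, u k ≤ (Real.log A + w / d + Real.log ρ) / ((d : ℝ) + 1) ^ n := fun k => by
    refine (hmono (Nat.le_add_left k n)).trans ?_
    rw [hu]
    dsimp only
    rw [div_le_div_iff₀ (hpos _) (hpos _), pow_add]
    nlinarith [(hb k).2, hpos n]
  obtain ⟨z, hz⟩ : ∃ z, Tendsto u atTop (𝓝 z) :=
    ⟨_, tendsto_atTop_ciSup hmono ⟨_, Set.forall_mem_range.2 hle⟩⟩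
  refine ⟨z, hz, ?_, le_of_tendsto' hz hle⟩
  have hlim : Tendsto (fun j : ℕ => (Real.log A + w / d) / ((d : ℝ) + 1) ^ n -
      w / d / ((d : ℝ) + 1) ^ n * (((d : ℝ) + 1)⁻¹) ^ j) atTop
      (𝓝 ((Real.log A + w / d) / ((d : ℝ) + 1) ^ n)) := by
    have := (tendsto_pow_atTop_nhds_zero_of_lt_one (r := ((d : ℝ) + 1)⁻¹) (by positivity)
      (inv_lt_one_of_one_lt₀ (by linarith))).const_mul (w / d / ((d : ℝ) + 1) ^ n)
    simpa using this.const_sub ((Real.log A + w / d) / ((d : ℝ) + 1) ^ n)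
  refine le_of_tendsto_of_tendsto' hlim (hz.comp (tendsto_add_atTop_nat n)) fun j => ?_
  have h₁ : (Real.log A + w / d) / ((d : ℝ) + 1) ^ n -
      w / d / ((d : ℝ) + 1) ^ n * (((d : ℝ) + 1)⁻¹) ^ j =
      ((d + 1) ^ j * (Real.log A + w / d) - w / d) / ((d : ℝ) + 1) ^ (n + j) := by
    rw [pow_add, inv_pow]
    field_simp
  rw [h₁, Function.comp_apply, add_comm j n]
  exact div_le_div_of_nonneg_right (hb j).1 (hpos _).le

/-! ### Numerical estimates -/

/-- Integer inequalities on the stage `4` numbers `c k`. The conditions on `k < 6` say that `c k` is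
`c 0 * x ^ k` with `x = c 1 / c 0`, up to a factor between `1` and `1 + 10 ^ (-28)`. The last two
conditions say that `N = (c 0 ^ 2 + c 1 ^ 2) ^ 10` and `Q = 2 ^ e * c 0 ^ 16` satisfy
`y ≤ (N - Q) / (N + Q) ≤ y'` with `y` and `y'` consecutive multiples of `10 ^ (-20)`, which locates
`log (N / Q) = log ((1 + y) / (1 - y))`. The exponent `e` is a variable because elaboration would
try to expand the power of two otherwise; its value is `13036`. -/
def StageFourEstimates (e : ℕ) (c : ℕ → ℕ) : Prop :=
  0 < c 0 ∧ 0 < c 1 ∧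
  (∀ k < 6, c 1 ^ k * c 0 ≤ c k * c 0 ^ k ∧
    10 ^ 28 * (c k * c 0 ^ k) ≤ (10 ^ 28 + 1) * (c 1 ^ k * c 0)) ∧
  27116426134114649837 * ((c 0 ^ 2 + c 1 ^ 2) ^ 10 + 2 ^ e * c 0 ^ 16) +
      10 ^ 20 * (2 ^ e * c 0 ^ 16) ≤ 10 ^ 20 * (c 0 ^ 2 + c 1 ^ 2) ^ 10 ∧
  10 ^ 20 * (c 0 ^ 2 + c 1 ^ 2) ^ 10 ≤
    27116426134114649838 * ((c 0 ^ 2 + c 1 ^ 2) ^ 10 + 2 ^ e * c 0 ^ 16) +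
      10 ^ 20 * (2 ^ e * c 0 ^ 16)

instance (e : ℕ) (c : ℕ → ℕ) : Decidable (StageFourEstimates e c) :=
  inferInstanceAs (Decidable (_ ∧ _ ∧ (∀ k < 6, _ ∧ _) ∧ _ ∧ _))

set_option maxRecDepth 10000 in
set_option exponentiation.threshold 20000 in
/-- Entry `5` of the sequence of lists belongs to stage `4`, by the shift in `cornerNumber`. -/
theorem stageFourEstimates_cornerNumberList :
    StageFourEstimates 13036 fun k => (cornerNumberList 5).getD k 0 := by
  have h : ((cornerNumberList 5).force fun l =>
      decide (StageFourEstimates 13036 fun k => l.getD k 0)) = true := by decide +kernel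
  rw [List.force_eq] at h
  exact of_decide_eq_true h

theorem log_two_bounds :
    (0.69314718055994530941723 : ℝ) ≤ Real.log 2 ∧
      Real.log 2 ≤ (0.69314718055994530941724 : ℝ) := by
  -- With `25` terms the remainder, of order `(1 / 3) ^ 51`, is below the last decimal.
  have h₁ := Real.sum_range_le_log_div (x := 1 / 3) (by norm_num) (by norm_num) 25
  have h₂ := Real.log_div_le_sum_range_add (x := 1 / 3) (by norm_num) (by norm_num) 25
  rw [show ((1 : ℝ) + 1 / 3) / (1 - 1 / 3) = 2 by norm_num] at h₁ h₂
  norm_num [Finset.sum_range_succ] at h₁ h₂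
  constructor <;> linarith

/-- The mantissa `N / Q` in `StageFourEstimates` is at least `(1 + y) / (1 - y)` for this `y`. -/
theorem mantissa_lower : (0.55624011829530633724 : ℝ) ≤
    Real.log ((1 + 27116426134114649837 / 10 ^ 20) / (1 - 27116426134114649837 / 10 ^ 20)) := by
  have h := Real.sum_range_le_log_div (x := 27116426134114649837 / 10 ^ 20)
    (by norm_num) (by norm_num) 18
  refine le_trans ?_ ((mul_le_mul_of_nonneg_left h zero_le_two).trans_eq (by ring))
  norm_num [Finset.sum_range_succ]

/-- The mantissa `N / Q` in `StageFourEstimates` is at most `(1 + y) / (1 - y)` for this `y`. -/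
theorem mantissa_upper :
    Real.log ((1 + 27116426134114649838 / 10 ^ 20) / (1 - 27116426134114649838 / 10 ^ 20)) ≤
      (0.55624011829530633730 : ℝ) := by
  have h := Real.log_div_le_sum_range_add (x := 27116426134114649838 / 10 ^ 20)
    (by norm_num) (by norm_num) 18
  refine le_trans (le_of_eq (by ring)) ((mul_le_mul_of_nonneg_left h zero_le_two).trans ?_)
  norm_num [Finset.sum_range_succ]

theorem log_div_add_log_le {y N Q : ℝ} (hy₀ : 0 ≤ y) (hy₁ : y < 1) (hQ : 0 < Q)
    (h : y * (N + Q) ≤ N - Q) : Real.log ((1 + y) / (1 - y)) + Real.log Q ≤ Real.log N := by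
  have hy : 0 < 1 - y := by linarith
  rw [← Real.log_mul (by positivity) hQ.ne']
  refine Real.log_le_log (by positivity) ?_
  rw [div_mul_eq_mul_div, div_le_iff₀ hy]
  linarith

theorem log_le_log_div_add_log {y N Q : ℝ} (hy₀ : 0 ≤ y) (hy₁ : y < 1) (hQ : 0 < Q) (hN : 0 < N)
    (h : N - Q ≤ y * (N + Q)) : Real.log N ≤ Real.log ((1 + y) / (1 - y)) + Real.log Q := by
  have hy : 0 < 1 - y := by linarith
  rw [← Real.log_mul (by positivity) hQ.ne']
  refine Real.log_le_log hN ?_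
  rw [div_mul_eq_mul_div, le_div_iff₀ hy]
  linarith

/-! ### The enclosure of the entropy -/

theorem StageFourEstimates.nearGeometric {e : ℕ} {c : ℕ → ℕ} (h : StageFourEstimates e c) :
    NearGeometric 4 c (c 0) (c 1 / c 0) (1 + 1 / 10 ^ 28) := by
  intro k hk
  have h0 : (0 : ℝ) < c 0 := Nat.cast_pos.2 h.1
  have hk' := h.2.2.1 k (by omega)
  have h₁ : (c 1 ^ k * c 0 : ℝ) ≤ c k * c 0 ^ k := by exact_mod_cast hk'.1
  have h₂ : (10 ^ 28 * (c k * c 0 ^ k) : ℝ) ≤ (10 ^ 28 + 1) * (c 1 ^ k * c 0) := by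
    exact_mod_cast hk'.2
  rw [div_pow, mul_div_assoc', mul_comm (c 0 : ℝ), mul_div_assoc', div_le_iff₀ (by positivity),
    le_div_iff₀ (by positivity)]
  exact ⟨h₁, by linarith⟩

/-- The bounds are scaled by `12500 = 4 * 5 ^ 5`, with `4` from the denominator of `w / d` and
`5 ^ 5` the number of vertices at stage `4`. -/
theorem StageFourEstimates.log_bounds {e : ℕ} {c : ℕ → ℕ} (h : StageFourEstimates e c)
    (he : e = 13036) :
    (0.72291383087181938879 * 12500 : ℝ) ≤
        4 * Real.log (c 0) + Real.log ((1 + (c 1 / c 0 : ℝ) ^ 2) ^ 10) ∧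
      4 * Real.log (c 0) + Real.log ((1 + (c 1 / c 0 : ℝ) ^ 2) ^ 10) + 4 / 10 ^ 28 <
        (0.72291383087181938880 * 12500 : ℝ) := by
  have h0 : (0 : ℝ) < c 0 := Nat.cast_pos.2 h.1
  obtain ⟨-, -, -, h₁, h₂⟩ := h
  have h₁ := (Nat.cast_le (α := ℝ)).2 h₁
  have h₂ := (Nat.cast_le (α := ℝ)).2 h₂
  push_cast at h₁ h₂
  have hN : (0 : ℝ) < ((c 0 : ℝ) ^ 2 + (c 1 : ℝ) ^ 2) ^ 10 := by positivity
  have hQ : (0 : ℝ) < 2 ^ e * (c 0 : ℝ) ^ 16 := by positivity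
  have hlogN : Real.log ((1 + (c 1 / c 0 : ℝ) ^ 2) ^ 10) =
      Real.log (((c 0 : ℝ) ^ 2 + (c 1 : ℝ) ^ 2) ^ 10) - 20 * Real.log (c 0) := by
    have : (1 + (c 1 / c 0 : ℝ) ^ 2) ^ 10 =
        ((c 0 : ℝ) ^ 2 + (c 1 : ℝ) ^ 2) ^ 10 / (c 0 : ℝ) ^ 20 := by
      field_simp
    rw [this, Real.log_div hN.ne' (by positivity), Real.log_pow]
    norm_num
  have hlogQ : Real.log (2 ^ e * (c 0 : ℝ) ^ 16) = 13036 * Real.log 2 + 16 * Real.log (c 0) := by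
    rw [Real.log_mul (by positivity) (by positivity), Real.log_pow, Real.log_pow, he]
    norm_num
  have hl := log_div_add_log_le (y := 27116426134114649837 / 10 ^ 20) (by norm_num) (by norm_num)
    hQ (N := ((c 0 : ℝ) ^ 2 + (c 1 : ℝ) ^ 2) ^ 10) (by linarith)
  have hu := log_le_log_div_add_log (y := 27116426134114649838 / 10 ^ 20) (by norm_num)
    (by norm_num) hQ hN (by linarith)
  rw [hlogQ] at hl hu
  rw [hlogN]
  have hm := mantissa_lower
  have hm' := mantissa_upper
  obtain ⟨ht, ht'⟩ := log_two_bounds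
  constructor <;> linarith

theorem stageFourEstimates_cornerNumber {e : ℕ} (he : e = 13036) :
    StageFourEstimates e (cornerNumber 4 5) := by
  have hc : ∀ k ≤ 5, cornerNumber 4 5 k = (cornerNumberList 5).getD k 0 := cornerNumber_four 5
  have h : StageFourEstimates e fun k => (cornerNumberList 5).getD k 0 :=
    he ▸ stageFourEstimates_cornerNumberList
  unfold StageFourEstimates at h ⊢
  rw [hc 0 (by norm_num), hc 1 (by norm_num)]
  refine ⟨h.1, h.2.1, fun k hk => ?_, h.2.2.2⟩
  rw [hc k (by omega)]
  exact h.2.2.1 k hk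

theorem mainTheorem6 :
    ∃ z : ℝ,
      Tendsto
        (fun n : ℕ =>
          Real.log (numDimerMonomers (towerOfHanoi 4 n) : ℝ) /
            (Fintype.card (Fin (n + 1) → Fin (4 + 1)) : ℝ))
        atTop (𝓝 z) ∧
      (0.72291383087181938879 : ℝ) ≤ z ∧ z < (0.72291383087181938880 : ℝ) := by
  obtain ⟨e, he⟩ : ∃ e, e = 13036 := ⟨_, rfl⟩
  have h := stageFourEstimates_cornerNumber he
  have h0 : (0 : ℝ) < cornerNumber 4 5 0 := Nat.cast_pos.2 h.1
  have h1 : (0 : ℝ) < cornerNumber 4 5 1 := Nat.cast_pos.2 h.2.1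
  obtain ⟨z, hz, hl, hu⟩ := exists_tendsto_log_cornerNumber four_ne_zero h0 (div_pos h1 h0)
    (by norm_num) h.nearGeometric rfl
  rw [patternSum_pow_five] at hl hu
  have hρ : Real.log (1 + 1 / 10 ^ 28) ≤ 1 / 10 ^ 28 :=
    (Real.log_le_sub_one_of_pos (by norm_num)).trans_eq (by ring)
  obtain ⟨hl', hu'⟩ := h.log_bounds he
  refine ⟨z, ?_, ?_, ?_⟩
  · refine (hz.comp (tendsto_add_atTop_nat 1)).congr fun n => ?_
    rw [Function.comp_apply, numDimerMonomers_towerOfHanoi, Fintype.card_fun, Fintype.card_fin,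
      Fintype.card_fin, Nat.cast_pow, Nat.cast_add_one 4]
  · refine le_trans ?_ hl
    rw [le_div_iff₀ (by positivity)]
    push_cast
    linarith
  · refine hu.trans_lt ?_
    rw [div_lt_iff₀ (by positivity)]
    push_cast
    linarith
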